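/- For an admissible index $\mathbf{k}=(k_1,\dots,k_r)$ (that is, $r\ge 1$, $k_1,\dots,k_{r-1}\ge 1$ and $k_r\ge 2$), let $$\zeta(\mathbf{k})=\sum_{0<m_1<\cdots<m_r}\frac{1}{m_1^{k_1}\cdots m_r^{k_r}},\qquad \zeta^{\star}(\mathbf{k})=\sum_{0<m_1\le\cdots\le m_r}\frac{1}{m_1^{k_1}\cdots m_r^{k_r}},$$ and, for $t\in\mathbb{R}$, let $\zeta^t(\mathbf{k})=\sum_{\mathbf{k}'}t^{\,r-\mathrm{dep}(\mathbf{k}')}\zeta(\mathbf{k}')$ be the interpolated multiple zeta value, where the sum runs over all $2^{r-1}$ indices of the form $\mathbf{k}'=(k_1\,\square\,k_2\,\square\cdots\square\,k_r)$ in which each $\square$ is filled by a comma or by a plus sign, and $\mathrm{dep}(\mathbf{k}')$ is the number of entries of $\mathbf{k}'$. Write $\{c\}^m$ for $c$ repeated $m$ times. Below, $a,b,k_1,k_2,\dots$ range over non-negative integers, and $0^0=1$. **Theorem.** For all integers $n,l\ge 0$ and all $t\in\mathbb{R}$, $$\sum_{a+b=n}(-1)^b\sum_{k_1+\cdots+k_{a+1}=l}\zeta^t(k_1+1,\dots,k_a+1,k_{a+1}+b+2)=\sum_{a+2b=n}t^a\binom{a+l}{l}\zeta^{\star}(a+l+2,\{2\}^b).$$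 In particular, when $t=0$, $$\sum_{a+b=n}(-1)^b\sum_{k_1+\cdots+k_{a+1}=l}\zeta(k_1+1,\dots,k_a+1,k_{a+1}+b+2)=\begin{cases}\zeta^{\star}(l+2,\{2\}^{c}) & \text{if } n=2c,\\ 0 & \text{if } n=2c+1,\end{cases}$$ and when $l=0$, $$\sum_{a+b=n}(-1)^b\,\zeta^t(\{1\}^a,b+2)=\sum_{a+2b=n}t^a\,\zeta^{\star}(a+2,\{2\}^b).$$ -/

import Mathlib

/-- The multiple zeta value of the index `k = (k₁, …, k_r)`: the sum over `0 < m₁ < ⋯ < m_r`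
of `1 / (m₁ ^ k₁ ⋯ m_r ^ k_r)`. The series converges for admissible indices
(`k₁, …, k_{r-1} ≥ 1` and `k_r ≥ 2`). -/
noncomputable def mzv (k : List ℕ) : ℝ :=
  ∑' m : {m : Fin k.length → ℕ // (∀ i, 0 < m i) ∧ StrictMono m},
    1 / ∏ i, (m.1 i : ℝ) ^ k.get i

/-- The multiple zeta-star value of the index `k = (k₁, …, k_r)`: the sum over
`0 < m₁ ≤ ⋯ ≤ m_r` of `1 / (m₁ ^ k₁ ⋯ m_r ^ k_r)`. -/
noncomputable def mzsv (k : List ℕ) : ℝ :=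
  ∑' m : {m : Fin k.length → ℕ // (∀ i, 0 < m i) ∧ Monotone m},
    1 / ∏ i, (m.1 i : ℝ) ^ k.get i

/-- `boxFillings k₁ [k₂, …, k_r]` lists (with repetitions) the `2 ^ (r - 1)` indices
`(k₁ □ k₂ □ ⋯ □ k_r)` in which each box is filled by a comma or by a plus sign.
The two summands of the second clause correspond to the filling of the first box. -/
def boxFillings : ℕ → List ℕ → List (List ℕ)
  | k, [] => [[k]]
  | k, k₂ :: ks => (boxFillings k₂ ks).map (fun k' => k :: k') ++ boxFillings (k + k₂) ks

/-- The interpolated multiple zeta value `ζ^t(k)`: the sum of `t ^ (r - dep k') ζ(k')` over all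
`k' = (k₁ □ ⋯ □ k_r)`, where `r` is the depth of `k`. (The value at the empty index is a
convention.) -/
noncomputable def interpolatedMZV (t : ℝ) : List ℕ → ℝ
  | [] => 1
  | k :: ks =>
    ((boxFillings k ks).map (fun k' => t ^ ((k :: ks).length - k'.length) * mzv k')).sum

/-- The index `(k₁ + 1, …, k_a + 1, k_{a+1} + b + 2)`. -/
def shiftedIndex {a : ℕ} (k : Fin (a + 1) → ℕ) (b : ℕ) : List ℕ :=
  List.ofFn (fun i : Fin a => k i.castSucc + 1) ++ [k (Fin.last a) + b + 2]

/-- The finite set of pairs `(a, b)` of natural numbers with `a + 2 b = n`. -/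
def pairsAddTwoMul (n : ℕ) : Finset (ℕ × ℕ) :=
  (Finset.range (n + 1) ×ˢ Finset.range (n + 1)).filter (fun p => p.1 + 2 * p.2 = n)

/-! The case of general `t` follows from `t = 0` by counting. An index of depth `N + 1 - i` whose
excess over the minimal weight is `l + i` arises by merging from exactly `(l + i).choose i` indices
of depth `N + 1` and excess `l`: refining it means choosing `i` of `l + i` possible cuts
(`boxedSum_eq_sum_plainSum`). Grouping by `i` writes the left side as a combination of the
alternating sums for `t = 0`.

For `t = 0`, fix `0 < x < 1` and compare generating functions in `x`, with `u = risingCoeff x` and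
`v = risingCoeff (1 - x)`. On the left, let `m + 1` be the largest variable. With a second parameter
`y` marking `l`, the smaller variables contribute `∏_{j ≤ m} (1 + x / (j - y))`. Multiplying by `1 /
(m + 1 - y)` and expanding in partial fractions in `y` gives `∑_{p + q = m} v_p u_q / (p + 1 - y)`,
while the alternating sum over `b` contributes `1 / (m + 1 + x)`. Summing over `q` first is a beta
integral, and what remains is `∑_p K_p / (p + 1) ^ (l + 2)` with `K = betaWeight x`.

The recurrence `betaWeight_succ` and Euler's sine product identify `K_p` with `∏_{j > p} (1 - x ^ 2
/ j ^ 2)⁻¹`. Expanding these geometric series gives the generating function of `ζ*(l + 2, {2}^c)` in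
`x ^ 2`, where `p + 1` is the smallest variable. So both sides equal `betaSeries x l`
(`hasSum_alternatingSum`, `hasSum_mzsv`), and coefficients are compared on `(0, 1)`. -/

section

open Finset MeasureTheory ProbabilityTheory
open scoped ENNReal

/-! ### Sums over tuples and the shape of shifted indices -/

/-- Splitting off the first entry in a sum over the tuples of given sum. -/
lemma sum_antidiagonalTuple_cons {M : Type*} [AddCommMonoid M] (a l : ℕ)
    (F : (Fin (a + 1) → ℕ) → M) :
    ∑ k ∈ Nat.antidiagonalTuple (a + 1) l, F k =
      ∑ p ∈ antidiagonal l, ∑ k ∈ Nat.antidiagonalTuple a p.2,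
        F (Fin.cons p.1 k : Fin (a + 1) → ℕ) := by
  rw [sum_sigma']
  refine sum_bij' (fun k _ => ⟨(k 0, ∑ i, Fin.tail k i), Fin.tail k⟩)
    (fun s _ => Fin.cons s.1.1 s.2) ?_ ?_ ?_ ?_ ?_
  · intro k hk
    rw [Nat.mem_antidiagonalTuple, Fin.sum_univ_succ] at hk
    simp [Nat.mem_antidiagonalTuple, Fin.tail, hk]
  · rintro ⟨⟨i, j⟩, k⟩ h
    simp only [mem_sigma, HasAntidiagonal.mem_antidiagonal, Nat.mem_antidiagonalTuple] at h
    rw [Nat.mem_antidiagonalTuple, Fin.sum_univ_succ]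
    simp [h.1, h.2]
  · intro k _
    exact Fin.cons_self_tail k
  · rintro ⟨⟨i, j⟩, k⟩ h
    simp only [mem_sigma, HasAntidiagonal.mem_antidiagonal, Nat.mem_antidiagonalTuple] at h
    obtain ⟨h1, h2⟩ := h
    subst h2
    simp
  · intro k _
    rw [Fin.cons_self_tail]

/-- Splitting off the last entry in a sum over the tuples of given sum. -/
lemma sum_antidiagonalTuple_snoc {M : Type*} [AddCommMonoid M] (a l : ℕ)
    (F : (Fin (a + 1) → ℕ) → M) :
    ∑ k ∈ Nat.antidiagonalTuple (a + 1) l, F k =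
      ∑ p ∈ antidiagonal l, ∑ k ∈ Nat.antidiagonalTuple a p.1,
        F (Fin.snoc k p.2 : Fin (a + 1) → ℕ) := by
  rw [sum_sigma']
  refine sum_bij' (fun k _ => ⟨(∑ i, Fin.init k i, k (Fin.last a)), Fin.init k⟩)
    (fun s _ => (Fin.snoc s.2 s.1.2 : Fin (a + 1) → ℕ)) ?_ ?_ ?_ ?_ ?_
  · intro k hk
    rw [Nat.mem_antidiagonalTuple, Fin.sum_univ_castSucc] at hk
    simp [Nat.mem_antidiagonalTuple, Fin.init, hk]
  · rintro ⟨⟨i, j⟩, k⟩ h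
    simp only [mem_sigma, HasAntidiagonal.mem_antidiagonal, Nat.mem_antidiagonalTuple] at h
    rw [Nat.mem_antidiagonalTuple, Fin.sum_univ_castSucc]
    simp [h.1, h.2]
  · intro k _
    exact Fin.snoc_init_self k
  · rintro ⟨⟨i, j⟩, k⟩ h
    simp only [mem_sigma, HasAntidiagonal.mem_antidiagonal, Nat.mem_antidiagonalTuple] at h
    obtain ⟨h1, h2⟩ := h
    subst h2
    simp
  · intro k _
    rw [Fin.snoc_init_self]

lemma shiftedIndex_zero (k : Fin 1 → ℕ) (b : ℕ) : shiftedIndex k b = [k 0 + b + 2] := by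
  simp [shiftedIndex]

lemma shiftedIndex_cons {a : ℕ} (i : ℕ) (k : Fin (a + 1) → ℕ) (b : ℕ) :
    shiftedIndex (Fin.cons i k : Fin (a + 2) → ℕ) b = (i + 1) :: shiftedIndex k b := by
  simp only [shiftedIndex, List.ofFn_succ, List.cons_append]
  congr 1

lemma exists_shiftedIndex_eq_cons {a : ℕ} (k : Fin (a + 1) → ℕ) (b : ℕ) :
    ∃ h ts, shiftedIndex k b = h :: ts := by
  cases hs : shiftedIndex k b with
  | nil => simp [shiftedIndex] at hs
  | cons h ts => exact ⟨h, ts, rfl⟩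

/-! ### Interpolated sums in terms of ordinary ones -/

/-- Add `c` to the first entry of an index. -/
def addHead (c : ℕ) : List ℕ → List ℕ
  | [] => []
  | k :: ks => (c + k) :: ks

/-- The `t`-weighted sum of a function over all box fillings of an index. -/
noncomputable def boxSum (t : ℝ) (Z : List ℕ → ℝ) : List ℕ → ℝ
  | [] => 1
  | k :: ks => ((boxFillings k ks).map (fun k' => t ^ ((k :: ks).length - k'.length) * Z k')).sum

lemma interpolatedMZV_eq_boxSum (t : ℝ) (k : List ℕ) :
    interpolatedMZV t k = boxSum t mzv k := by
  cases k <;> rfl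

lemma length_le_of_mem_boxFillings (ks : List ℕ) :
    ∀ (k : ℕ) (k' : List ℕ), k' ∈ boxFillings k ks → k'.length ≤ ks.length + 1 := by
  induction ks with
  | nil => intro k k' h; simp [boxFillings] at h; simp [h]
  | cons k₂ ks ih =>
    intro k k' h
    simp only [boxFillings, List.mem_append, List.mem_map] at h
    rcases h with ⟨k'', h, rfl⟩ | h
    · simpa using ih _ _ h
    · have := ih _ _ h
      simp only [List.length_cons]
      omega

lemma boxSum_cons_cons (t : ℝ) (Z : List ℕ → ℝ) (k k₂ : ℕ) (ks : List ℕ) :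
    boxSum t Z (k :: k₂ :: ks) =
      boxSum t (fun L => Z (k :: L)) (k₂ :: ks) + t * boxSum t Z ((k + k₂) :: ks) := by
  simp only [boxSum, boxFillings, List.map_append, List.sum_append, List.map_map]
  congr 1
  · simp [Function.comp_def]
  · rw [← List.sum_map_mul_left]
    congr 1
    refine List.map_congr_left fun k' hk' => ?_
    have := length_le_of_mem_boxFillings _ _ _ hk'
    simp only [List.length_cons]
    rw [← mul_assoc, ← pow_succ']
    congr 2
    omega

/-- The sum of `Z (c + k₁ + 1, k₂ + 1, …, k_{a+1} + b + 2)` over `k₁ + ⋯ + k_{a+1} = l`. -/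
noncomputable def plainSum (b : ℕ) : ℕ → ℕ → ℕ → (List ℕ → ℝ) → ℝ
  | 0, l, c, Z => Z [c + l + b + 2]
  | a + 1, l, c, Z => ∑ p ∈ antidiagonal l, plainSum b a p.2 0 (fun L => Z ((c + p.1 + 1) :: L))

/-- The interpolated version of `plainSum`. -/
noncomputable def boxedSum (t : ℝ) (b : ℕ) : ℕ → ℕ → ℕ → (List ℕ → ℝ) → ℝ
  | 0, l, c, Z => Z [c + l + b + 2]
  | a + 1, l, c, Z => ∑ p ∈ antidiagonal l,
      (boxedSum t b a p.2 0 (fun L => Z ((c + p.1 + 1) :: L)) +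
        t * boxedSum t b a p.2 (c + p.1 + 1) Z)

lemma addHead_zero (L : List ℕ) : addHead 0 L = L := by
  cases L <;> simp [addHead]

lemma plainSum_eq (b a l c : ℕ) (Z : List ℕ → ℝ) :
    plainSum b a l c Z =
      ∑ k ∈ Nat.antidiagonalTuple (a + 1) l, Z (addHead c (shiftedIndex k b)) := by
  induction a generalizing l c Z with
  | zero => simp [plainSum, shiftedIndex_zero, addHead, add_assoc]
  | succ a ih =>
    rw [plainSum, sum_antidiagonalTuple_cons]
    refine sum_congr rfl fun p _ => ?_
    rw [ih]
    refine sum_congr rfl fun k _ => ?_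
    rw [shiftedIndex_cons, addHead_zero, addHead, add_assoc]

lemma boxedSum_eq (t : ℝ) (b a l c : ℕ) (Z : List ℕ → ℝ) :
    boxedSum t b a l c Z =
      ∑ k ∈ Nat.antidiagonalTuple (a + 1) l, boxSum t Z (addHead c (shiftedIndex k b)) := by
  induction a generalizing l c Z with
  | zero => simp [boxedSum, boxSum, boxFillings, shiftedIndex_zero, addHead, add_assoc]
  | succ a ih =>
    rw [boxedSum, sum_antidiagonalTuple_cons]
    refine sum_congr rfl fun p _ => ?_
    rw [ih, ih, mul_sum, ← sum_add_distrib]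
    refine sum_congr rfl fun k _ => ?_
    obtain ⟨h, ts, hs⟩ := exists_shiftedIndex_eq_cons k b
    rw [shiftedIndex_cons, addHead_zero, addHead, hs, boxSum_cons_cons, addHead, add_assoc]

lemma plainSum_zero_succ (b l c : ℕ) (Z : List ℕ → ℝ) :
    plainSum b 0 (l + 1) c Z = plainSum b 0 l (c + 1) Z := by
  simp only [plainSum]
  congr 2
  omega

lemma plainSum_succ_zero (b a c : ℕ) (Z : List ℕ → ℝ) :
    plainSum b (a + 1) 0 c Z = plainSum b a 0 0 (fun L => Z ((c + 1) :: L)) := by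
  simp [plainSum]

/-- Either `k₁ > 0`, and one unit of it moves into the offset `c`, or `k₁ = 0`, and the first entry
is finished. The offset exists to make this recursion possible. -/
lemma plainSum_succ_succ (b a l c : ℕ) (Z : List ℕ → ℝ) :
    plainSum b (a + 1) (l + 1) c Z =
      plainSum b (a + 1) l (c + 1) Z + plainSum b a (l + 1) 0 (fun L => Z ((c + 1) :: L)) := by
  rw [plainSum, Nat.sum_antidiagonal_succ, add_comm, plainSum]
  congr 1
  refine sum_congr rfl fun p _ => ?_
  simp only [add_assoc, add_comm 1]

lemma boxedSum_succ_zero (t : ℝ) (b a c : ℕ) (Z : List ℕ → ℝ) :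
    boxedSum t b (a + 1) 0 c Z =
      boxedSum t b a 0 0 (fun L => Z ((c + 1) :: L)) + t * boxedSum t b a 0 (c + 1) Z := by
  simp [boxedSum]

lemma boxedSum_succ_succ (t : ℝ) (b a l c : ℕ) (Z : List ℕ → ℝ) :
    boxedSum t b (a + 1) (l + 1) c Z =
      boxedSum t b (a + 1) l (c + 1) Z +
        (boxedSum t b a (l + 1) 0 (fun L => Z ((c + 1) :: L)) +
          t * boxedSum t b a (l + 1) (c + 1) Z) := by
  rw [boxedSum, Nat.sum_antidiagonal_succ, add_comm, boxedSum]
  congr 1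
  refine sum_congr rfl fun p _ => ?_
  simp only [add_assoc, add_comm 1]

/-- Interpolated sums in terms of plain ones. -/
lemma boxedSum_eq_sum_plainSum (t : ℝ) (b N l c : ℕ) (Z : List ℕ → ℝ) :
    boxedSum t b N l c Z =
      ∑ p ∈ antidiagonal N, t ^ p.1 * ((p.1 + l).choose p.1 : ℝ) *
        plainSum b p.2 (l + p.1) c Z := by
  induction N generalizing l c Z with
  | zero => simp [boxedSum, plainSum]
  | succ N ihN =>
    induction l generalizing c Z with
    | zero =>
      rw [boxedSum_succ_zero, ihN, ihN, Nat.sum_antidiagonal_succ]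
      simp only [pow_zero, zero_add, plainSum_succ_zero, add_zero,
        Nat.choose_self, Nat.cast_one, mul_one, one_mul]
      rw [mul_sum]
      -- The head recursion is applied to every term. The finished heads give a sum over first
      -- components `p.1 + 1`, hence the subtracted term, which is the one with first component `0`.
      have key : ∀ (N : ℕ) , ∑ p ∈ antidiagonal N, t ^ (p.1 + 1) * plainSum b p.2 (p.1 + 1) c Z
        = ∑ p ∈ antidiagonal N, t * (t ^ p.1 * plainSum b p.2 p.1 (c + 1) Z) +
          (∑ p ∈ antidiagonal N, t ^ p.1 * plainSum b p.2 p.1 0 (fun L => Z ((c + 1) :: L))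
            - plainSum b N 0 0 (fun L => Z ((c + 1) :: L))) := by
        intro N
        cases N with
        | zero => simp [plainSum_zero_succ]
        | succ N =>
          rw [Nat.sum_antidiagonal_succ (f := fun p : ℕ × ℕ =>
            t ^ p.1 * plainSum b p.2 p.1 0 (fun L => Z ((c + 1) :: L)))]
          rw [Nat.sum_antidiagonal_succ', Nat.sum_antidiagonal_succ' (f := fun p : ℕ × ℕ =>
            t * (t ^ p.1 * plainSum b p.2 p.1 (c + 1) Z))]
          simp only [plainSum_zero_succ, plainSum_succ_succ, mul_add, sum_add_distrib, pow_succ]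
          simp only [pow_zero, one_mul, mul_assoc, mul_left_comm _ t]
          ring
      rw [key]
      ring
    | succ l ihl =>
      rw [boxedSum_succ_succ, ihl, ihN, ihN, mul_sum]
      have h1 : ∑ p ∈ antidiagonal (N + 1), t ^ p.1 * ((p.1 + (l + 1)).choose p.1 : ℝ) *
          plainSum b p.2 (l + 1 + p.1) c Z =
          ∑ p ∈ antidiagonal (N + 1), t ^ p.1 * ((p.1 + (l + 1)).choose p.1 : ℝ) *
            plainSum b p.2 (l + p.1) (c + 1) Z +
          ∑ p ∈ antidiagonal N, t ^ p.1 * ((p.1 + (l + 1)).choose p.1 : ℝ) *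
            plainSum b p.2 (l + 1 + p.1) 0 (fun L => Z ((c + 1) :: L)) := by
        rw [Nat.sum_antidiagonal_succ', Nat.sum_antidiagonal_succ' (f := fun p : ℕ × ℕ =>
          t ^ p.1 * ((p.1 + (l + 1)).choose p.1 : ℝ) * plainSum b p.2 (l + p.1) (c + 1) Z)]
        simp only [add_right_comm l 1, plainSum_zero_succ, plainSum_succ_succ, mul_add,
          sum_add_distrib]
        ring
      -- Pascal's rule splits each coefficient with `p.1 > 0`; for `p.1 = 0` both binomials are `1`.
      have h2 : ∑ p ∈ antidiagonal (N + 1), t ^ p.1 * ((p.1 + (l + 1)).choose p.1 : ℝ) *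
            plainSum b p.2 (l + p.1) (c + 1) Z =
          ∑ p ∈ antidiagonal (N + 1), t ^ p.1 * ((p.1 + l).choose p.1 : ℝ) *
            plainSum b p.2 (l + p.1) (c + 1) Z +
          ∑ p ∈ antidiagonal N, t * (t ^ p.1 * ((p.1 + (l + 1)).choose p.1 : ℝ) *
            plainSum b p.2 (l + 1 + p.1) (c + 1) Z) := by
        rw [Nat.sum_antidiagonal_succ, Nat.sum_antidiagonal_succ (f := fun p : ℕ × ℕ =>
          t ^ p.1 * ((p.1 + l).choose p.1 : ℝ) * plainSum b p.2 (l + p.1) (c + 1) Z), add_assoc,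
          ← sum_add_distrib]
        simp only [zero_add, Nat.choose_zero_right]
        congr 1
        refine sum_congr rfl fun p _ => ?_
        have : (p.1 + 1 + (l + 1)).choose (p.1 + 1) =
            (p.1 + (l + 1)).choose p.1 + (p.1 + 1 + l).choose (p.1 + 1) := by
          rw [show p.1 + 1 + (l + 1) = (p.1 + (l + 1)) + 1 by ring, Nat.choose_succ_succ,
            show p.1 + (l + 1) = p.1 + 1 + l by ring]
        rw [this, show l + (p.1 + 1) = l + 1 + p.1 by ring]
        push_cast
        ring
      rw [h1, h2]
      ring

/-! ### Multiple zeta values as sums over chains in `ℝ≥0∞` -/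

/-- Chains of positive integers `m₁, …, m_r` with `m_i < m_j + e` for `i < j`, all of whose entries
satisfy `P`: strictly increasing for `e = 0` and weakly increasing for `e = 1`. -/
def IsChainBelow (e : ℕ) {r : ℕ} (P : ℕ → Prop) (m : Fin r → ℕ) : Prop :=
  (∀ i, 0 < m i) ∧ (∀ i j, i < j → m i < m j + e) ∧ ∀ i, P (m i)

/-- Since `e ≤ 1`, every entry is at most the last one, so a downward closed `P` need only be
checked at `M`. -/
lemma isChainBelow_snoc {e r : ℕ} (he : e ≤ 1) {P : ℕ → Prop} (hP : ∀ i j, i ≤ j → P j → P i)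
    (m : Fin r → ℕ) (M : ℕ) :
    IsChainBelow e P (Fin.snoc m M : Fin (r + 1) → ℕ) ↔
      (0 < M ∧ P M) ∧ IsChainBelow e (fun i => i < M + e) m := by
  simp only [IsChainBelow, Fin.forall_fin_succ', Fin.snoc_castSucc, Fin.snoc_last,
    Fin.castSucc_lt_castSucc_iff, Fin.castSucc_lt_last, lt_irrefl, false_imp_iff, true_imp_iff,
    and_true]
  constructor
  · rintro ⟨⟨h1, h2⟩, ⟨h3, -⟩, -, h5⟩
    exact ⟨⟨h2, h5⟩, h1, fun i => (h3 i).1, fun i => (h3 i).2⟩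
  · rintro ⟨⟨h1, h2⟩, h3, h4, h5⟩
    refine ⟨⟨h3, h1⟩, ⟨fun i => ⟨h4 i, h5 i⟩, fun i h => ?_⟩, fun i => hP _ M ?_ h2, h2⟩
    · exact absurd h (not_lt.2 (Fin.le_last _))
    · have := h5 i
      omega

open Classical in
/-- The sum of `1 / (m₁ ^ k₁ ⋯ m_r ^ k_r)` over the chains in `IsChainBelow e P`. -/
noncomputable def chainSum (e r : ℕ) (k : Fin r → ℕ) (P : ℕ → Prop) : ℝ≥0∞ :=
  ∑' m : Fin r → ℕ,
    if IsChainBelow e P m then ENNReal.ofReal (1 / ∏ i, (m i : ℝ) ^ k i) else 0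

open Classical in
lemma chainSum_succ {e r : ℕ} (he : e ≤ 1) (k : Fin (r + 1) → ℕ) {P : ℕ → Prop}
    (hP : ∀ i j, i ≤ j → P j → P i) :
    chainSum e (r + 1) k P = ∑' n : ℕ, if P (n + 1) then
      ENNReal.ofReal (1 / ((n : ℝ) + 1) ^ k (Fin.last r)) *
        chainSum e r (Fin.init k) (fun i => i < n + 1 + e) else 0 := by
  rw [chainSum, ← (Fin.snocEquiv (fun _ => ℕ)).tsum_eq, ENNReal.tsum_prod',
    tsum_eq_zero_add' ENNReal.summable]
  -- A last variable equal to `0` violates positivity, so the sum over it starts at `1` and is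
  -- indexed by `n + 1`.
  have h0 : ∑' m : Fin r → ℕ, (if IsChainBelow e P (Fin.snocEquiv (fun _ => ℕ) (0, m)) then
      ENNReal.ofReal (1 / ∏ i, ((Fin.snocEquiv (fun _ => ℕ) (0, m) i : ℕ) : ℝ) ^ k i)
        else 0) = 0 := by
    rw [ENNReal.tsum_eq_zero]
    intro m
    rw [if_neg]
    intro h
    have := h.1 (Fin.last r)
    simp [Fin.snocEquiv] at this
  rw [h0, zero_add]
  refine tsum_congr fun n => ?_
  have key : ∀ m : Fin r → ℕ, IsChainBelow e P (Fin.snocEquiv (fun _ => ℕ) (n + 1, m)) ↔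
      P (n + 1) ∧ IsChainBelow e (fun i => i < n + 1 + e) m := by
    intro m
    have := isChainBelow_snoc he hP m (n + 1)
    simpa using! this
  simp only [key]
  split_ifs with h
  · rw [chainSum, ← ENNReal.tsum_mul_left]
    refine tsum_congr fun m => ?_
    simp only [h, true_and]
    split_ifs with h2
    · rw [← ENNReal.ofReal_mul (by positivity), Fin.prod_univ_castSucc]
      congr 1
      simp only [Fin.snocEquiv, Fin.init, Equiv.coe_fn_mk, Fin.snoc_castSucc, Fin.snoc_last]
      push_cast
      rw [one_div_mul_one_div, mul_comm]
    · rw [mul_zero]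
  · simp [h]

/-- The sum of `1 / (m₁ ^ k₁ ⋯ m_r ^ k_r)` over the chains with entries at most `N`. -/
noncomputable def truncSum (e : ℕ) : (r : ℕ) → (Fin r → ℕ) → ℕ → ℝ
  | 0, _, _ => 1
  | r + 1, k, N => ∑ n ∈ range N,
      1 / ((n : ℝ) + 1) ^ k (Fin.last r) * truncSum e r (Fin.init k) (n + e)

lemma truncSum_nonneg (e r : ℕ) (k : Fin r → ℕ) (N : ℕ) : 0 ≤ truncSum e r k N := by
  induction r generalizing N with
  | zero => exact zero_le_one
  | succ r ih =>
    rw [truncSum]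
    exact sum_nonneg fun n _ => mul_nonneg (by positivity) (ih _ _)

lemma chainSum_eq_truncSum {e : ℕ} (he : e ≤ 1) (r : ℕ) (k : Fin r → ℕ) (N : ℕ) :
    chainSum e r k (fun i => i < N + 1) = ENNReal.ofReal (truncSum e r k N) := by
  induction r generalizing N with
  | zero => simp [chainSum, truncSum, IsChainBelow]
  | succ r ih =>
    rw [chainSum_succ he k (fun i j hij hj => hij.trans_lt hj), truncSum,
      ENNReal.ofReal_sum_of_nonneg
        (fun n _ => mul_nonneg (by positivity) (truncSum_nonneg _ _ _ _)),
      tsum_eq_sum (s := range N)]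
    · refine sum_congr rfl fun n hn => ?_
      rw [if_pos (by simpa using hn), ENNReal.ofReal_mul (by positivity), ← ih, add_right_comm]
    · intro n hn
      rw [if_neg (by simpa using hn)]

lemma chainSum_top_succ {e : ℕ} (he : e ≤ 1) (r : ℕ) (k : Fin (r + 1) → ℕ) :
    chainSum e (r + 1) k (fun _ => True) = ∑' n : ℕ, ENNReal.ofReal
      (1 / ((n : ℝ) + 1) ^ k (Fin.last r) * truncSum e r (Fin.init k) (n + e)) := by
  rw [chainSum_succ he k (fun _ _ _ _ => trivial)]
  refine tsum_congr fun n => ?_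
  rw [if_pos trivial, ENNReal.ofReal_mul (by positivity), ← chainSum_eq_truncSum he,
    add_right_comm]

lemma toReal_chainSum_top (e r : ℕ) (k : Fin r → ℕ) :
    (chainSum e r k (fun _ => True)).toReal =
      ∑' m : {m : Fin r → ℕ // (∀ i, 0 < m i) ∧ ∀ i j, i < j → m i < m j + e},
        1 / ∏ i, (m.1 i : ℝ) ^ k i := by
  classical
  have h : chainSum e r k (fun _ => True) =
      ∑' m : {m : Fin r → ℕ // (∀ i, 0 < m i) ∧ ∀ i j, i < j → m i < m j + e},
        ENNReal.ofReal (1 / ∏ i, (m.1 i : ℝ) ^ k i) := by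
    rw [chainSum]
    have := tsum_subtype {m : Fin r → ℕ | (∀ i, 0 < m i) ∧ ∀ i j, i < j → m i < m j + e}
      (fun m => ENNReal.ofReal (1 / ∏ i, (m i : ℝ) ^ k i))
    refine Eq.trans ?_ this.symm
    refine tsum_congr fun m => ?_
    simp [IsChainBelow, Set.indicator]
  -- No convergence is needed here: for a divergent series both sides take the default value `0`.
  rw [h, ENNReal.tsum_toReal_eq (fun _ => ENNReal.ofReal_ne_top)]
  exact tsum_congr fun m => ENNReal.toReal_ofReal (by positivity)

lemma mzv_eq_chainSum (L : List ℕ) :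
    mzv L = (chainSum 0 L.length L.get (fun _ => True)).toReal := by
  rw [toReal_chainSum_top]
  rfl

lemma mzsv_eq_chainSum (L : List ℕ) :
    mzsv L = (chainSum 1 L.length L.get (fun _ => True)).toReal := by
  rw [toReal_chainSum_top, mzsv]
  have h : ∀ m : Fin L.length → ℕ, ((∀ i, 0 < m i) ∧ Monotone m) ↔
      ((∀ i, 0 < m i) ∧ ∀ i j, i < j → m i < m j + 1) := by
    intro m
    rw [monotone_iff_forall_lt]
    simp only [Nat.lt_succ_iff]
  exact (Equiv.subtypeEquivRight h).tsum_eq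
    (fun m => 1 / ∏ i, (m.1 i : ℝ) ^ L.get i)

lemma chainSum_congr (e : ℕ) {r r' : ℕ} (h : r = r') (k : Fin r → ℕ) (k' : Fin r' → ℕ)
    (hk : ∀ i, k i = k' (Fin.cast h i)) (P : ℕ → Prop) :
    chainSum e r k P = chainSum e r' k' P := by
  subst h
  congr 1
  exact funext hk

lemma mzv_ofFn {r : ℕ} (k : Fin r → ℕ) :
    mzv (List.ofFn k) = (chainSum 0 r k (fun _ => True)).toReal := by
  rw [mzv_eq_chainSum, chainSum_congr 0 (List.length_ofFn) _ k]
  intro i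
  rw [List.get_ofFn]

lemma mzsv_ofFn {r : ℕ} (k : Fin r → ℕ) :
    mzsv (List.ofFn k) = (chainSum 1 r k (fun _ => True)).toReal := by
  rw [mzsv_eq_chainSum, chainSum_congr 1 (List.length_ofFn) _ k]
  intro i
  rw [List.get_ofFn]

/-! ### Binomial coefficients, beta integrals and the weights `betaWeight` -/

/-- The coefficient `x (x + 1) ⋯ (x + q - 1) / q!` of `s ^ q` in `(1 - s) ^ (-x)`. -/
noncomputable def risingCoeff (x : ℝ) : ℕ → ℝ
  | 0 => 1
  | q + 1 => risingCoeff x q * (x + q) / (q + 1)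

lemma risingCoeff_pos {x : ℝ} (hx : 0 < x) (q : ℕ) : 0 < risingCoeff x q := by
  induction q with
  | zero => exact one_pos
  | succ q ih => rw [risingCoeff]; positivity

lemma succ_mul_risingCoeff_succ (x : ℝ) (q : ℕ) :
    ((q : ℝ) + 1) * risingCoeff x (q + 1) = risingCoeff x q * (x + q) := by
  rw [risingCoeff]
  field_simp

lemma risingCoeff_eq_choose (x : ℝ) (q : ℕ) : risingCoeff x q = Ring.choose (x + q - 1) q := by
  have h : ∀ q : ℕ, (q.factorial : ℝ) * risingCoeff x q = (ascPochhammer ℕ q).smeval x := by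
    intro q
    induction q with
    | zero => simp [risingCoeff]
    | succ q ih =>
      rw [ascPochhammer_succ_right, Polynomial.smeval_mul, ← ih, Polynomial.smeval_add,
        Polynomial.smeval_X, Polynomial.smeval_natCast, Nat.factorial_succ]
      push_cast
      have := succ_mul_risingCoeff_succ x q
      simp only [pow_one, pow_zero, nsmul_eq_mul, mul_one]
      linear_combination (q.factorial : ℝ) * this
  have h2 : Ring.choose (x + q - 1) q = Ring.multichoose x q := by
    rw [Ring.choose]
    congr 1
    ring
  rw [h2]
  have h3 := Ring.factorial_nsmul_multichoose_eq_ascPochhammer x q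
  rw [← h q, nsmul_eq_mul] at h3
  exact (mul_left_cancel₀ (by positivity) h3).symm

lemma hasSum_risingCoeff_mul_pow (x : ℝ) {s : ℝ} (hs0 : 0 ≤ s) (hs : s < 1) :
    HasSum (fun q => risingCoeff x q * s ^ q) ((1 - s) ^ (-x)) := by
  have h := (Real.one_div_one_sub_rpow_hasFPowerSeriesOnBall_zero x).hasSum (y := s)
    (by simp [enorm_eq_nnnorm, ← NNReal.coe_lt_coe, abs_of_nonneg hs0, hs])
  simp only [zero_add, FormalMultilinearSeries.ofScalars_apply_eq] at h
  rw [Real.rpow_neg (by linarith), ← one_div]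
  simpa only [risingCoeff_eq_choose, smul_eq_mul] using h

lemma setLIntegral_beta {α β : ℝ} (hα : 0 < α) (hβ : 0 < β) :
    ∫⁻ s in Set.Ioo (0 : ℝ) 1, ENNReal.ofReal (s ^ (α - 1) * (1 - s) ^ (β - 1)) =
      ENNReal.ofReal (beta α β) := by
  have h := lintegral_betaPDF_eq_one hα hβ
  have hb := beta_pos hα hβ
  rw [lintegral_betaPDF] at h
  have h2 : ∀ s : ℝ, ENNReal.ofReal (1 / beta α β * s ^ (α - 1) * (1 - s) ^ (β - 1)) =
      ENNReal.ofReal (1 / beta α β) * ENNReal.ofReal (s ^ (α - 1) * (1 - s) ^ (β - 1)) := by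
    intro s
    rw [← ENNReal.ofReal_mul (by positivity), mul_assoc]
  simp only [h2] at h
  rw [lintegral_const_mul _ (by fun_prop)] at h
  have h3 : ENNReal.ofReal (beta α β) * ENNReal.ofReal (1 / beta α β) = 1 := by
    rw [← ENNReal.ofReal_mul hb.le, mul_one_div_cancel hb.ne', ENNReal.ofReal_one]
  rw [← one_mul (∫⁻ _ in _, _), ← h3, mul_assoc, h, mul_one]

lemma beta_one_right {α : ℝ} (hα : 0 < α) : beta α 1 = 1 / α := by
  have := (Real.Gamma_pos_of_pos hα).ne'
  rw [beta, Real.Gamma_one, Real.Gamma_add_one hα.ne']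
  field_simp

/-- The binomial series, integrated against `s ^ (c - 1)`. -/
lemma hasSum_risingCoeff_div {x c : ℝ} (hx0 : 0 < x) (hx1 : x < 1) (hc : 0 < c) :
    HasSum (fun q : ℕ => risingCoeff x q / (c + q)) (beta c (1 - x)) := by
  have hx : 0 < 1 - x := by linarith
  have hnn : ∀ q : ℕ, 0 ≤ risingCoeff x q / (c + q) := fun q =>
    div_nonneg (risingCoeff_pos hx0 q).le (by positivity)
  have key : ∑' q : ℕ, ENNReal.ofReal (risingCoeff x q / (c + q)) =
      ENNReal.ofReal (beta c (1 - x)) := by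
    rw [← setLIntegral_beta hc hx]
    -- Writing `1 / (c + q)` as the beta integral with second parameter `1` lets Tonelli sum the
    -- binomial series to `(1 - s) ^ (-x)` under the integral.
    have h1 : ∀ q : ℕ, ENNReal.ofReal (risingCoeff x q / (c + q)) =
        ∫⁻ s in Set.Ioo (0 : ℝ) 1, ENNReal.ofReal (risingCoeff x q) *
          ENNReal.ofReal (s ^ (c + q - 1) * (1 - s) ^ ((1 : ℝ) - 1)) := by
      intro q
      rw [lintegral_const_mul _ (by fun_prop), setLIntegral_beta (by positivity) one_pos,
        beta_one_right (by positivity), ← ENNReal.ofReal_mul (risingCoeff_pos hx0 q).le,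
        mul_one_div]
    simp only [h1]
    rw [← lintegral_tsum (fun q => by fun_prop)]
    refine setLIntegral_congr_fun measurableSet_Ioo fun s hs => ?_
    obtain ⟨hs0, hs1⟩ := hs
    have h2 : ∀ q : ℕ, ENNReal.ofReal (risingCoeff x q) *
          ENNReal.ofReal (s ^ (c + q - 1) * (1 - s) ^ ((1 : ℝ) - 1)) =
        ENNReal.ofReal (s ^ (c - 1) * (risingCoeff x q * s ^ q)) := by
      intro q
      rw [← ENNReal.ofReal_mul (risingCoeff_pos hx0 q).le, sub_self, Real.rpow_zero, mul_one,
        show c + q - 1 = (c - 1) + q by ring, Real.rpow_add_natCast hs0.ne']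
      congr 1
      ring
    simp only [h2]
    have h3 := (hasSum_risingCoeff_mul_pow x hs0.le hs1).mul_left (s ^ (c - 1))
    rw [← ENNReal.ofReal_tsum_of_nonneg _ h3.summable, h3.tsum_eq]
    · congr 3
      ring
    · intro q
      have := risingCoeff_pos hx0 q
      positivity
  have hsum : Summable fun q : ℕ => risingCoeff x q / (c + q) := by
    have h := ENNReal.summable_toReal (f := fun q : ℕ => ENNReal.ofReal (risingCoeff x q / (c + q)))
      (by rw [key]; exact ENNReal.ofReal_ne_top)
    simpa only [ENNReal.toReal_ofReal (hnn _)] using h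
  rw [← ENNReal.ofReal_tsum_of_nonneg hnn hsum,
    ENNReal.ofReal_eq_ofReal_iff (tsum_nonneg hnn) (beta_pos hc hx).le] at key
  rw [← key]
  exact hsum.hasSum

/-- The value of `(m + 1) ∑_q v_m u_q / (m + 1 + q + x)`, where `u = risingCoeff x` and
`v = risingCoeff (1 - x)`. -/
noncomputable def betaWeight (x : ℝ) (m : ℕ) : ℝ :=
  (m + 1) * risingCoeff (1 - x) m * beta (m + 1 + x) (1 - x)

lemma betaWeight_pos {x : ℝ} (hx0 : 0 < x) (hx1 : x < 1) (m : ℕ) : 0 < betaWeight x m := by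
  have h1 : 0 < 1 - x := by linarith
  have := risingCoeff_pos h1 m
  have := beta_pos (α := m + 1 + x) (by positivity) h1
  rw [betaWeight]
  positivity

/-- The three factors change by `(m + 2) / (m + 1)`, `(m + 1 - x) / (m + 1)` and `(m + 1 + x) / (m +
2)`, whose product is a factor of Euler's sine product. -/
lemma betaWeight_succ {x : ℝ} (hx0 : 0 < x) (m : ℕ) :
    betaWeight x (m + 1) = betaWeight x m * (1 - x ^ 2 / ((m : ℝ) + 1) ^ 2) := by
  have h := succ_mul_risingCoeff_succ (1 - x) m
  have hb : beta (((m + 1 : ℕ) : ℝ) + 1 + x) (1 - x) * (m + 2) =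
      beta (m + 1 + x) (1 - x) * (m + 1 + x) := by
    have h1 : Real.Gamma ((m : ℝ) + 2) ≠ 0 := (Real.Gamma_pos_of_pos (by positivity)).ne'
    have h2 : (m : ℝ) + 2 ≠ 0 := by positivity
    rw [beta, beta]
    push_cast
    rw [show (m : ℝ) + 1 + 1 + x = (m + 1 + x) + 1 by ring,
      Real.Gamma_add_one (s := (m : ℝ) + 1 + x) (by positivity),
      show (m : ℝ) + 1 + x + 1 + (1 - x) = (m + 2) + 1 by ring,
      show (m : ℝ) + 1 + x + (1 - x) = m + 2 by ring,
      Real.Gamma_add_one h2]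
    field_simp
  have h3 : (m : ℝ) + 1 ≠ 0 := by positivity
  rw [betaWeight, betaWeight]
  generalize beta (((m + 1 : ℕ) : ℝ) + 1 + x) (1 - x) = b1 at *
  generalize beta (m + 1 + x) (1 - x) = b0 at *
  generalize risingCoeff (1 - x) (m + 1) = r1 at *
  generalize risingCoeff (1 - x) m = r0 at *
  rw [eq_comm, ← mul_left_inj' (pow_ne_zero 2 h3)]
  have : (1 - x ^ 2 / ((m : ℝ) + 1) ^ 2) * ((m : ℝ) + 1) ^ 2 = (m + 1) ^ 2 - x ^ 2 := by
    field_simp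
  push_cast
  linear_combination (m + 1) * r0 * b0 * this - (m + 1) ^ 2 * r1 * hb
    - (m + 1) * b0 * (m + 1 + x) * h

/-- This is the reflection formula for `Γ(x) Γ(1 - x)`; it supplies the constant that normalizes the
limit of the weights to `1`. -/
lemma betaWeight_zero {x : ℝ} (hx0 : 0 < x) (hx1 : x < 1) :
    betaWeight x 0 * Real.sin (Real.pi * x) = Real.pi * x := by
  have hpi := Real.pi_pos
  have hs : 0 < Real.sin (Real.pi * x) :=
    Real.sin_pos_of_pos_of_lt_pi (by positivity) (by nlinarith)
  have h := Real.Gamma_mul_Gamma_one_sub x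
  rw [betaWeight, beta, Nat.cast_zero, zero_add, add_comm 1 x, Real.Gamma_add_one hx0.ne',
    show x + 1 + (1 - x) = 2 by ring, Real.Gamma_two, mul_assoc x, h, risingCoeff]
  generalize Real.sin (Real.pi * x) = S at *
  field_simp

lemma tendsto_betaWeight {x : ℝ} (hx0 : 0 < x) (hx1 : x < 1) :
    Filter.Tendsto (betaWeight x) Filter.atTop (nhds 1) := by
  have hprod : ∀ n, betaWeight x n =
      betaWeight x 0 * ∏ j ∈ range n, (1 - x ^ 2 / ((j : ℝ) + 1) ^ 2) := by
    intro n
    induction n with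
    | zero => simp
    | succ n ih => rw [betaWeight_succ hx0, ih, prod_range_succ, mul_assoc]
  have h := (Real.tendsto_euler_sin_prod x).const_mul (betaWeight x 0 / (Real.pi * x))
  have hpi := Real.pi_pos
  have h1 : betaWeight x 0 / (Real.pi * x) * Real.sin (Real.pi * x) = 1 := by
    rw [div_mul_eq_mul_div, betaWeight_zero hx0 hx1]
    exact div_self (by positivity)
  rw [h1] at h
  refine h.congr fun n => ?_
  have hpx : Real.pi * x ≠ 0 := by positivity
  rw [hprod n, ← mul_assoc, div_mul_cancel₀ _ hpx]

/-! ### The generating function of the strict sums and its partial fractions -/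

/-- The sum of the truncated multiple zeta values of the indices `(k₁ + 1, …, k_a + 1)` with
`k₁ + ⋯ + k_a = l`. -/
noncomputable def strictPart (a l N : ℕ) : ℝ :=
  ∑ k ∈ Nat.antidiagonalTuple a l, truncSum 0 a (fun i => k i + 1) N

/-- The part of `strictPart (a + 1) l` whose largest variable is `n + 1`. -/
noncomputable def strictLast (a l n : ℕ) : ℝ :=
  ∑ p ∈ antidiagonal l, strictPart a p.1 n * (1 / ((n : ℝ) + 1) ^ (p.2 + 1))

lemma strictPart_nonneg (a l N : ℕ) : 0 ≤ strictPart a l N :=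
  sum_nonneg fun _ _ => truncSum_nonneg _ _ _ _

lemma strictLast_nonneg (a l n : ℕ) : 0 ≤ strictLast a l n :=
  sum_nonneg fun _ _ => mul_nonneg (strictPart_nonneg _ _ _) (by positivity)

lemma strictPart_zero (l N : ℕ) : strictPart 0 l N = if l = 0 then 1 else 0 := by
  cases l <;> simp [strictPart, truncSum]

lemma strictPart_succ (a l N : ℕ) : strictPart (a + 1) l N = ∑ n ∈ range N, strictLast a l n := by
  simp only [strictPart, strictLast]
  rw [sum_antidiagonalTuple_snoc, sum_comm]
  refine sum_congr rfl fun p _ => ?_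
  simp only [truncSum, sum_mul]
  rw [sum_comm]
  refine sum_congr rfl fun n _ => sum_congr rfl fun k _ => ?_
  rw [mul_comm, Fin.snoc_last, add_zero]
  congr 2
  ext i
  simp [Fin.init]

lemma strictPart_succ_succ (a l N : ℕ) :
    strictPart (a + 1) l (N + 1) = strictPart (a + 1) l N + strictLast a l N := by
  rw [strictPart_succ, strictPart_succ, sum_range_succ]

lemma shiftedIndex_snoc {a : ℕ} (k : Fin a → ℕ) (j b : ℕ) :
    shiftedIndex (Fin.snoc k j : Fin (a + 1) → ℕ) b =
      List.ofFn (Fin.snoc (fun i => k i + 1) (j + b + 2) : Fin (a + 1) → ℕ) := by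
  rw [List.ofFn_succ', List.concat_eq_append, shiftedIndex]
  simp

/-- The largest variable is taken outside. The interchange is done in `ℝ≥0∞`; summability makes the
total finite, so that it can be carried back to `ℝ`. -/
lemma sum_mzv_shiftedIndex (a l b : ℕ)
    (hs : Summable fun n : ℕ => strictLast a l n * (1 / ((n : ℝ) + 1) ^ (b + 1))) :
    ∑ k ∈ Nat.antidiagonalTuple (a + 1) l, mzv (shiftedIndex k b) =
      ∑' n : ℕ, strictLast a l n * (1 / ((n : ℝ) + 1) ^ (b + 1)) := by
  have hnn : ∀ n : ℕ, 0 ≤ strictLast a l n * (1 / ((n : ℝ) + 1) ^ (b + 1)) := fun n =>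
    mul_nonneg (strictLast_nonneg _ _ _) (by positivity)
  have key : ∑ p ∈ antidiagonal l, ∑ k ∈ Nat.antidiagonalTuple a p.1,
      chainSum 0 (a + 1) (Fin.snoc (fun i => k i + 1) (p.2 + b + 2) : Fin (a + 1) → ℕ)
        (fun _ => True) =
      ENNReal.ofReal (∑' n : ℕ, strictLast a l n * (1 / ((n : ℝ) + 1) ^ (b + 1))) := by
    rw [ENNReal.ofReal_tsum_of_nonneg hnn hs]
    simp only [chainSum_top_succ zero_le_one]
    have h1 : ∀ n : ℕ, ENNReal.ofReal (strictLast a l n * (1 / ((n : ℝ) + 1) ^ (b + 1))) =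
        ∑ p ∈ antidiagonal l, ∑ k ∈ Nat.antidiagonalTuple a p.1, ENNReal.ofReal
          (1 / ((n : ℝ) + 1) ^ (p.2 + b + 2) * truncSum 0 a (fun i => k i + 1) n) := by
      intro n
      have hk : ∀ (p : ℕ × ℕ) (k : Fin a → ℕ),
          0 ≤ 1 / ((n : ℝ) + 1) ^ (p.2 + b + 2) * truncSum 0 a (fun i => k i + 1) n :=
        fun p k => mul_nonneg (by positivity) (truncSum_nonneg _ _ _ _)
      rw [strictLast, sum_mul, ENNReal.ofReal_sum_of_nonneg (fun p _ =>
        mul_nonneg (mul_nonneg (strictPart_nonneg _ _ _) (by positivity)) (by positivity))]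
      refine sum_congr rfl fun p _ => ?_
      rw [← ENNReal.ofReal_sum_of_nonneg (fun k _ => hk p k), ← mul_sum, ← strictPart]
      congr 1
      field_simp
      ring
    simp only [h1]
    rw [Summable.tsum_finsetSum (fun _ _ => ENNReal.summable)]
    refine sum_congr rfl fun p _ => ?_
    rw [Summable.tsum_finsetSum (fun _ _ => ENNReal.summable)]
    refine sum_congr rfl fun k _ => tsum_congr fun n => ?_
    rw [Fin.snoc_last, Fin.init_snoc, add_zero]
  -- Each summand is finite because the total is. This is essential, since `toReal` is additive only
  -- on finite values.
  have hfin : ∀ p ∈ antidiagonal l, ∑ k ∈ Nat.antidiagonalTuple a p.1,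
      chainSum 0 (a + 1) (Fin.snoc (fun i => k i + 1) (p.2 + b + 2) : Fin (a + 1) → ℕ)
        (fun _ => True) ≠ ∞ := by
    refine (ENNReal.sum_ne_top).1 ?_
    rw [key]
    exact ENNReal.ofReal_ne_top
  have h2 := congrArg ENNReal.toReal key
  rw [ENNReal.toReal_ofReal (tsum_nonneg hnn), ENNReal.toReal_sum hfin] at h2
  rw [← h2, sum_antidiagonalTuple_snoc]
  refine sum_congr rfl fun p hp => ?_
  rw [ENNReal.toReal_sum (ENNReal.sum_ne_top.1 (hfin p hp))]
  refine sum_congr rfl fun k _ => ?_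
  rw [shiftedIndex_snoc, mzv_ofFn]

/-- `∑_{p + q = m} v_p u_q = 1` for `u = risingCoeff x` and `v = risingCoeff (1 - x)`. -/
lemma sum_risingCoeff_mul_risingCoeff (x : ℝ) (m : ℕ) :
    ∑ p ∈ antidiagonal m, risingCoeff (1 - x) p.1 * risingCoeff x p.2 = 1 := by
  induction m with
  | zero => simp [risingCoeff]
  | succ m ih =>
    -- This is the coefficient form of `(1 - s) ^ (-(1 - x)) * (1 - s) ^ (-x) = (1 - s)⁻¹`.
    -- Weighting by `p.1 + p.2 = m + 1` differentiates the product, and the recurrences of `u` and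
    -- `v` return `m + 1` times the previous sum.
    have h1 : ((m : ℝ) + 1) * ∑ p ∈ antidiagonal (m + 1),
        risingCoeff (1 - x) p.1 * risingCoeff x p.2 =
        ∑ p ∈ antidiagonal (m + 1), (p.1 * risingCoeff (1 - x) p.1) * risingCoeff x p.2 +
        ∑ p ∈ antidiagonal (m + 1), risingCoeff (1 - x) p.1 * (p.2 * risingCoeff x p.2) := by
      rw [mul_sum, ← sum_add_distrib]
      refine sum_congr rfl fun p hp => ?_
      have : (p.1 : ℝ) + p.2 = m + 1 := by exact_mod_cast HasAntidiagonal.mem_antidiagonal.1 hp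
      rw [← this]
      ring
    rw [Nat.sum_antidiagonal_succ (f := fun p : ℕ × ℕ =>
        (p.1 * risingCoeff (1 - x) p.1) * risingCoeff x p.2),
      Nat.sum_antidiagonal_succ' (f := fun p : ℕ × ℕ => risingCoeff (1 - x) p.1 * (p.2 * risingCoeff x p.2))] at h1
    push_cast at h1
    simp only [succ_mul_risingCoeff_succ, zero_mul, mul_zero, zero_add] at h1
    rw [← sum_add_distrib] at h1
    have h2 : ∑ p ∈ antidiagonal m, (risingCoeff (1 - x) p.1 * (1 - x + p.1) * risingCoeff x p.2 +
        risingCoeff (1 - x) p.1 * (risingCoeff x p.2 * (x + p.2))) =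
        (m + 1) * ∑ p ∈ antidiagonal m, risingCoeff (1 - x) p.1 * risingCoeff x p.2 := by
      rw [mul_sum]
      refine sum_congr rfl fun p hp => ?_
      have : (p.1 : ℝ) + p.2 = m := by exact_mod_cast HasAntidiagonal.mem_antidiagonal.1 hp
      rw [← this]
      ring
    rw [h2, ih] at h1
    exact mul_left_cancel₀ (by positivity) h1

/-- The sum `∑_{p + q = m} v_p u_q / (p + 1) ^ (l + 1)`, for `u = risingCoeff x` and
`v = risingCoeff (1 - x)`. -/
noncomputable def partialFrac (x : ℝ) (m l : ℕ) : ℝ :=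
  ∑ p ∈ antidiagonal m,
    risingCoeff (1 - x) p.1 * risingCoeff x p.2 * (1 / ((p.1 : ℝ) + 1) ^ (l + 1))

/-- The value of `∑_a x ^ a * strictPart a l m`. -/
noncomputable def strictGen (x : ℝ) (m l : ℕ) : ℝ :=
  (if l = 0 then 1 else 0) + ∑ p ∈ antidiagonal m,
    risingCoeff (1 - x) p.1 * (p.2 * risingCoeff x p.2) * (1 / ((p.1 : ℝ) + 1) ^ (l + 1))

lemma strictGen_zero_left (x : ℝ) (l : ℕ) : strictGen x 0 l = if l = 0 then 1 else 0 := by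
  simp [strictGen]

lemma strictGen_succ (x : ℝ) (m l : ℕ) :
    strictGen x (m + 1) l = strictGen x m l + x * partialFrac x m l := by
  rw [strictGen, Nat.sum_antidiagonal_succ', strictGen, partialFrac, mul_sum, add_assoc,
    ← sum_add_distrib]
  push_cast
  simp only [succ_mul_risingCoeff_succ, zero_mul, mul_zero, zero_add]
  congr 1
  refine sum_congr rfl fun p _ => ?_
  ring

/-- For `p + q = m`, the factor `m + 1` splits as `(p + 1) + q`. The first part cancels one power of
`p + 1`, the second gives the terms of `strictGen`. Together with the next lemma this says that, for
the series in `y`, multiplying `partialFrac` by `m + 1 - y` gives `strictGen`. -/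
lemma succ_mul_partialFrac_zero (x : ℝ) (m : ℕ) :
    ((m : ℝ) + 1) * partialFrac x m 0 = strictGen x m 0 := by
  rw [strictGen, if_pos rfl]
  refine Eq.trans ?_ (congrArg (fun y => y + _) (sum_risingCoeff_mul_risingCoeff x m))
  rw [partialFrac, mul_sum, ← sum_add_distrib]
  refine sum_congr rfl fun p hp => ?_
  have : (p.1 : ℝ) + p.2 = m := by exact_mod_cast HasAntidiagonal.mem_antidiagonal.1 hp
  rw [← this]
  field_simp
  ring

lemma succ_mul_partialFrac_succ (x : ℝ) (m l : ℕ) :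
    ((m : ℝ) + 1) * partialFrac x m (l + 1) = partialFrac x m l + strictGen x m (l + 1) := by
  rw [strictGen, if_neg (Nat.succ_ne_zero l), partialFrac, partialFrac, mul_sum, zero_add,
    ← sum_add_distrib]
  refine sum_congr rfl fun p hp => ?_
  have : (p.1 : ℝ) + p.2 = m := by exact_mod_cast HasAntidiagonal.mem_antidiagonal.1 hp
  rw [← this]
  field_simp
  ring

lemma sum_strictGen_mul (x : ℝ) (m l : ℕ) :
    ∑ p ∈ antidiagonal l, strictGen x m p.1 * (1 / ((m : ℝ) + 1) ^ (p.2 + 1)) =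
      partialFrac x m l := by
  have hm : (m : ℝ) + 1 ≠ 0 := by positivity
  induction l with
  | zero =>
    simp only [Nat.antidiagonal_zero, sum_singleton, zero_add, pow_one]
    rw [← succ_mul_partialFrac_zero]
    field_simp
  | succ l ih =>
    rw [Nat.sum_antidiagonal_succ']
    have h : ∑ p ∈ antidiagonal l, strictGen x m p.1 * (1 / ((m : ℝ) + 1) ^ (p.2 + 1 + 1)) =
        (1 / ((m : ℝ) + 1)) * partialFrac x m l := by
      rw [← ih, mul_sum]
      refine sum_congr rfl fun p _ => ?_
      field_simp
      ring
    rw [h]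
    have h2 := succ_mul_partialFrac_succ x m l
    simp only [zero_add, pow_one]
    field_simp
    linarith

lemma hasSum_strictLast_of_hasSum_strictPart {x : ℝ} {m : ℕ}
    (h : ∀ l, HasSum (fun a => x ^ a * strictPart a l m) (strictGen x m l)) (l : ℕ) :
    HasSum (fun a => x ^ a * strictLast a l m) (partialFrac x m l) := by
  rw [← sum_strictGen_mul]
  refine (hasSum_sum (s := antidiagonal l)
    (f := fun (p : ℕ × ℕ) a => x ^ a * strictPart a p.1 m * (1 / ((m : ℝ) + 1) ^ (p.2 + 1)))
    (a := fun p => strictGen x m p.1 * (1 / ((m : ℝ) + 1) ^ (p.2 + 1)))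
    (fun p _ => (h p.1).mul_right _)).congr_fun ?_
  intro a
  rw [strictLast, mul_sum]
  exact sum_congr rfl fun p _ => by ring

/-- Both sides obey the same recurrence in `m`. No bound on `x` is required, because there are no
strict chains of length `a > m` in `{1, …, m}` and the series is a finite sum. -/
lemma hasSum_strictPart (x : ℝ) (m l : ℕ) :
    HasSum (fun a => x ^ a * strictPart a l m) (strictGen x m l) := by
  induction m generalizing l with
  | zero =>
    rw [strictGen_zero_left]
    have h := hasSum_ite_eq (0 : ℕ) (if l = 0 then (1 : ℝ) else 0)
    convert h using 2 with a
    cases a with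
    | zero => simp [strictPart_zero]
    | succ a => simp [strictPart_succ]
  | succ m ih =>
    have h1 := (hasSum_strictLast_of_hasSum_strictPart ih l).mul_left x
    have h2 := (hasSum_nat_add_iff' 1).2 (ih l)
    have h3 := h2.add h1
    rw [strictGen_succ]
    rw [← hasSum_nat_add_iff' 1]
    convert h3 using 1
    · ext a
      rw [strictPart_succ_succ]
      ring
    · simp only [sum_range_one, strictPart_zero]
      ring

lemma hasSum_strictLast (x : ℝ) (m l : ℕ) :
    HasSum (fun a => x ^ a * strictLast a l m) (partialFrac x m l) :=
  hasSum_strictLast_of_hasSum_strictPart (hasSum_strictPart x m) l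

/-! ### Summation over the largest variable: the generating function of the left side -/

lemma HasSum.sum_antidiagonal {f : ℕ × ℕ → ℝ} {s : ℝ} (h : HasSum f s) :
    HasSum (fun n => ∑ p ∈ HasAntidiagonal.antidiagonal n, f p) s := by
  have h1 := (HasAntidiagonal.sigmaAntidiagonalEquivProd (A := ℕ)).hasSum_iff.2 h
  refine h1.sigma fun n => ?_
  have h2 := hasSum_fintype (fun c : HasAntidiagonal.antidiagonal n => f c)
  rwa [sum_coe_sort (HasAntidiagonal.antidiagonal n) f] at h2

lemma HasSum.mul_prod {f g : ℕ → ℝ} {s t : ℝ} (hf : HasSum f s) (hg : HasSum g t) :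
    HasSum (fun p : ℕ × ℕ => f p.1 * g p.2) (s * t) :=
  hf.mul hg (summable_mul_of_summable_norm hf.summable.norm hg.summable.norm)

lemma hasSum_pow_div_pow_succ {M y : ℝ} (hM : 0 < M) (hy : |y| < M) :
    HasSum (fun b : ℕ => y ^ b * (1 / M ^ (b + 1))) (1 / (M - y)) := by
  have h := (hasSum_geometric_of_abs_lt_one (r := y / M)
    (by rwa [abs_div, abs_of_pos hM, div_lt_one hM])).mul_left (1 / M)
  have h1 : M - y ≠ 0 := by linarith [(abs_lt.1 hy).2]
  have h2 : 1 / (M - y) = 1 / M * (1 - y / M)⁻¹ := by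
    rw [one_sub_div hM.ne', inv_div]
    field_simp
  rw [h2]
  refine h.congr_fun fun b => ?_
  rw [div_pow]
  field_simp
  ring

lemma summable_one_div_succ_pow (l : ℕ) : Summable fun n : ℕ => 1 / ((n : ℝ) + 1) ^ (l + 2) := by
  have h := (summable_nat_add_iff 1).2
    (Real.summable_one_div_nat_pow.2 (show 1 < l + 2 by omega))
  simpa using h

lemma summable_betaWeight_mul {x : ℝ} (hx0 : 0 < x) (hx1 : x < 1) (l : ℕ) :
    Summable fun n : ℕ => betaWeight x n * (1 / ((n : ℝ) + 1) ^ (l + 2)) := by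
  obtain ⟨C, hC⟩ := (tendsto_betaWeight hx0 hx1).bddAbove_range
  refine Summable.of_nonneg_of_le
    (fun n => mul_nonneg (betaWeight_pos hx0 hx1 n).le (by positivity)) (fun n => ?_)
    ((summable_one_div_succ_pow l).mul_left C)
  exact mul_le_mul_of_nonneg_right (hC ⟨n, rfl⟩) (by positivity)

/-- The common value of the generating functions of both sides of the sum formula. -/
noncomputable def betaSeries (x : ℝ) (l : ℕ) : ℝ :=
  ∑' n : ℕ, betaWeight x n * (1 / ((n : ℝ) + 1) ^ (l + 2))

lemma partialFrac_nonneg {x : ℝ} (hx0 : 0 < x) (hx1 : x < 1) (m l : ℕ) :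
    0 ≤ partialFrac x m l := by
  refine sum_nonneg fun p _ => ?_
  have := risingCoeff_pos hx0 p.2
  have := risingCoeff_pos (sub_pos.2 hx1) p.1
  positivity

/-- All terms of the double series over `(p, q)` are nonnegative, so it may be summed either along
`p + q = m` or over `q` first. The latter gives the beta value hidden in `betaWeight`. -/
lemma hasSum_partialFrac_div {x : ℝ} (hx0 : 0 < x) (hx1 : x < 1) (l : ℕ) :
    HasSum (fun m : ℕ => partialFrac x m l * (1 / ((m : ℝ) + 1 + x))) (betaSeries x l) := by
  set F : ℕ × ℕ → ℝ := fun p => risingCoeff (1 - x) p.1 * (1 / ((p.1 : ℝ) + 1) ^ (l + 1)) *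
    (risingCoeff x p.2 / ((p.1 : ℝ) + 1 + x + p.2)) with hF
  have hF0 : 0 ≤ F := by
    intro p
    have := risingCoeff_pos hx0 p.2
    have := risingCoeff_pos (sub_pos.2 hx1) p.1
    simp only [hF, Pi.zero_apply]
    positivity
  have hfib : ∀ p : ℕ, HasSum (fun q => F (p, q))
      (betaWeight x p * (1 / ((p : ℝ) + 1) ^ (l + 2))) := by
    intro p
    have h := (hasSum_risingCoeff_div hx0 hx1 (c := (p : ℝ) + 1 + x) (by positivity)).mul_left
      (risingCoeff (1 - x) p * (1 / ((p : ℝ) + 1) ^ (l + 1)))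
    have h2 : betaWeight x p * (1 / ((p : ℝ) + 1) ^ (l + 2)) =
        risingCoeff (1 - x) p * (1 / ((p : ℝ) + 1) ^ (l + 1)) *
          ProbabilityTheory.beta ((p : ℝ) + 1 + x) (1 - x) := by
      rw [betaWeight]
      field_simp
      ring
    rw [h2]
    exact h
  have hsum : Summable F := by
    rw [summable_prod_of_nonneg hF0]
    refine ⟨fun p => (hfib p).summable, ?_⟩
    simp only [(hfib _).tsum_eq]
    exact summable_betaWeight_mul hx0 hx1 l
  have h1 : HasSum F (betaSeries x l) := by
    have h2 := hsum.hasSum.prod_fiberwise hfib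
    rw [betaSeries, h2.tsum_eq]
    exact hsum.hasSum
  refine h1.sum_antidiagonal.congr_fun fun m => ?_
  rw [partialFrac, sum_mul]
  refine sum_congr rfl fun p hp => ?_
  have : (p.1 : ℝ) + p.2 = m := by exact_mod_cast HasAntidiagonal.mem_antidiagonal.1 hp
  simp only [hF]
  rw [← this, show (p.1 : ℝ) + p.2 + 1 + x = p.1 + 1 + x + p.2 by ring]
  ring

/-- This is the series with the signs `(-1) ^ b` removed, and it provides absolute convergence. The
ratio `(m + 1 + x) / (m + 1 - x)` is largest at `m = 0`, whence the constant `(1 + x) / (1 - x)`. -/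
lemma summable_partialFrac_div {x : ℝ} (hx0 : 0 < x) (hx1 : x < 1) (l : ℕ) :
    Summable (fun m : ℕ => partialFrac x m l * (1 / ((m : ℝ) + 1 - x))) := by
  have hpos : ∀ m : ℕ, 0 < (m : ℝ) + 1 - x := fun m => by
    have : (0 : ℝ) ≤ m := by positivity
    linarith
  refine Summable.of_nonneg_of_le
    (fun m => mul_nonneg (partialFrac_nonneg hx0 hx1 m l) (one_div_pos.2 (hpos m)).le)
    (fun m => ?_) ((hasSum_partialFrac_div hx0 hx1 l).summable.mul_left ((1 + x) / (1 - x)))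
  rw [mul_left_comm]
  refine mul_le_mul_of_nonneg_left ?_ (partialFrac_nonneg hx0 hx1 m l)
  have h1 : 0 < 1 - x := by linarith
  have h2 : 0 < (m : ℝ) + 1 + x := by positivity
  rw [div_mul_div_comm, div_le_div_iff₀ (hpos m) (by positivity)]
  have : 0 ≤ (m : ℝ) * x := by positivity
  nlinarith

lemma hasSum_strictLast_mul {x y : ℝ} (hx1 : x < 1) (hy : |y| = x) (m l : ℕ) :
    HasSum (fun p : ℕ × ℕ => (x ^ p.1 * strictLast p.1 l m) *
      (y ^ p.2 * (1 / ((m : ℝ) + 1) ^ (p.2 + 1))))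
      (partialFrac x m l * (1 / ((m : ℝ) + 1 - y))) := by
  have hM : (0 : ℝ) < m + 1 := by positivity
  have hyM : |y| < m + 1 := by
    have : (0 : ℝ) ≤ m := by positivity
    linarith
  exact (hasSum_strictLast x m l).mul_prod (hasSum_pow_div_pow_succ hM hyM)

/-- The alternating sum on the left-hand side of the sum formula for multiple zeta values. -/
noncomputable def alternatingSum (n l : ℕ) : ℝ :=
  ∑ p ∈ antidiagonal n, (-1 : ℝ) ^ p.2 *
    ∑ k ∈ Nat.antidiagonalTuple (p.1 + 1) l, mzv (shiftedIndex k p.2)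

/-- The family over `(m, a, b)` is dominated by its unsigned version `T x`. Summing over `(a, b)`
first evaluates it; summing over `m` first produces the zeta values. -/
lemma hasSum_alternatingSum {x : ℝ} (hx0 : 0 < x) (hx1 : x < 1) (l : ℕ) :
    HasSum (fun n => alternatingSum n l * x ^ n) (betaSeries x l) := by
  set T : ℝ → ℕ × (ℕ × ℕ) → ℝ := fun y z => (x ^ z.2.1 * strictLast z.2.1 l z.1) *
    (y ^ z.2.2 * (1 / ((z.1 : ℝ) + 1) ^ (z.2.2 + 1))) with hT
  have hT0 : 0 ≤ T x := by
    intro z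
    have := strictLast_nonneg z.2.1 l z.1
    simp only [hT, Pi.zero_apply]
    positivity
  have hsumpos : Summable (T x) := by
    rw [summable_prod_of_nonneg hT0]
    have h := fun m => hasSum_strictLast_mul hx1 (abs_of_pos hx0) m l
    refine ⟨fun m => (h m).summable, ?_⟩
    simp only [hT, (h _).tsum_eq]
    exact summable_partialFrac_div hx0 hx1 l
  have hnorm : ∀ z, ‖T (-x) z‖ = T x z := by
    intro z
    have := strictLast_nonneg z.2.1 l z.1
    simp only [hT]
    rw [norm_mul, norm_mul (_ ^ _) (1 / _), norm_pow, norm_neg, Real.norm_of_nonneg hx0.le,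
      Real.norm_of_nonneg (by positivity), Real.norm_of_nonneg (by positivity)]
  have hsum : Summable (T (-x)) := Summable.of_norm (by simpa only [hnorm] using hsumpos)
  have htot : HasSum (T (-x)) (betaSeries x l) := by
    have h := hsum.hasSum.prod_fiberwise (fun m =>
      hasSum_strictLast_mul hx1 (y := -x) (by rw [abs_neg, abs_of_pos hx0]) m l)
    simp only [sub_neg_eq_add] at h
    rw [(hasSum_partialFrac_div hx0 hx1 l).unique h]
    exact hsum.hasSum
  have hswap : HasSum (fun z : (ℕ × ℕ) × ℕ => T (-x) (z.2, z.1)) (betaSeries x l) :=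
    (Equiv.prodComm (ℕ × ℕ) ℕ).hasSum_iff.2 htot
  have hfib : ∀ p : ℕ × ℕ, HasSum (fun m => T (-x) (m, p)) (((-1) ^ p.2 *
      ∑ k ∈ Nat.antidiagonalTuple (p.1 + 1) l, mzv (shiftedIndex k p.2)) * x ^ (p.1 + p.2)) := by
    intro p
    -- Convergence for each single `(a, b)` is read off from the summable total family, after
    -- dividing by a nonzero constant.
    have hs : Summable fun m : ℕ => strictLast p.1 l m * (1 / ((m : ℝ) + 1) ^ (p.2 + 1)) := by
      have h := (hswap.summable.prod_factor p).mul_left ((-x) ^ (p.2) * x ^ p.1)⁻¹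
      refine h.congr fun m => ?_
      have h1 : (-x) ^ p.2 ≠ 0 := pow_ne_zero _ (by linarith)
      simp only [hT]
      field_simp
    rw [sum_mzv_shiftedIndex _ _ _ hs]
    have h := hs.hasSum.mul_left ((-x) ^ (p.2) * x ^ p.1)
    have h2 : ∀ W : ℝ, (-1) ^ p.2 * W * x ^ (p.1 + p.2) = (-x) ^ p.2 * x ^ p.1 * W := by
      intro W
      rw [neg_pow x, pow_add]
      ring
    rw [h2]
    refine h.congr_fun fun m => ?_
    simp only [hT]
    ring
  refine (hswap.prod_fiberwise hfib).sum_antidiagonal.congr_fun fun n => ?_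
  rw [alternatingSum, sum_mul]
  refine sum_congr rfl fun p hp => ?_
  rw [HasAntidiagonal.mem_antidiagonal.1 hp]

/-! ### The generating function of the zeta-star values -/

/-- The truncated multiple zeta-star value of `(l + 2, {2}^c)`. -/
noncomputable def starPart (l c N : ℕ) : ℝ :=
  truncSum 1 (c + 1) (Fin.cons (l + 2) fun _ => 2) N

/-- The part of the zeta-star value of `(l + 2, {2}^c)` whose largest variable is `n + 1`. -/
noncomputable def starLast (l : ℕ) : ℕ → ℕ → ℝ
  | 0, n => 1 / ((n : ℝ) + 1) ^ (l + 2)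
  | c + 1, n => 1 / ((n : ℝ) + 1) ^ 2 * starPart l c (n + 1)

lemma starLast_nonneg (l c n : ℕ) : 0 ≤ starLast l c n := by
  cases c with
  | zero => rw [starLast]; positivity
  | succ c => exact mul_nonneg (by positivity) (truncSum_nonneg _ _ _ _)

lemma starLast_eq (l c n : ℕ) :
    1 / ((n : ℝ) + 1) ^ (Fin.cons (l + 2) (fun _ => 2) : Fin (c + 1) → ℕ) (Fin.last c) *
      truncSum 1 c (Fin.init (Fin.cons (l + 2) (fun _ => 2) : Fin (c + 1) → ℕ)) (n + 1) =
      starLast l c n := by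
  cases c with
  | zero => simp [truncSum, starLast]
  | succ c =>
    have h : Fin.init (Fin.cons (l + 2) (fun _ => 2) : Fin (c + 2) → ℕ) =
        (Fin.cons (l + 2) (fun _ => 2) : Fin (c + 1) → ℕ) := by
      ext i
      refine Fin.cases ?_ (fun j => ?_) i
      · rfl
      · rw [Fin.cons_succ]
        rfl
    rw [h, ← Fin.succ_last, Fin.cons_succ, starLast, starPart]

lemma starPart_eq (l c N : ℕ) : starPart l c N = ∑ n ∈ range N, starLast l c n := by
  rw [starPart, truncSum]
  exact sum_congr rfl fun n _ => starLast_eq l c n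

lemma starPart_succ (l c N : ℕ) : starPart l c (N + 1) = starPart l c N + starLast l c N := by
  rw [starPart_eq, starPart_eq, sum_range_succ]

lemma mzsv_eq_tsum (l c : ℕ) :
    mzsv ((l + 2) :: List.replicate c 2) = ∑' n : ℕ, starLast l c n := by
  have h : (l + 2) :: List.replicate c 2 =
      List.ofFn (Fin.cons (l + 2) (fun _ => 2) : Fin (c + 1) → ℕ) := by
    rw [List.ofFn_cons, List.ofFn_const]
  rw [h, mzsv_ofFn, chainSum_top_succ le_rfl, ENNReal.tsum_toReal_eq
    (fun _ => ENNReal.ofReal_ne_top)]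
  refine tsum_congr fun n => ?_
  rw [starLast_eq, ENNReal.toReal_ofReal (starLast_nonneg _ _ _)]

/-- Unrolling the recurrence shows that `α` is the Cauchy product of `β` with the geometric series
of ratio `r`. -/
lemma hasSum_of_geometric_recurrence {α β : ℕ → ℝ} {r s : ℝ} (hr0 : 0 ≤ r) (hr1 : r < 1)
    (hβ : HasSum β s) (h0 : α 0 = β 0) (hsucc : ∀ c, α (c + 1) = β (c + 1) + r * α c) :
    HasSum α (s / (1 - r)) := by
  have hg := hasSum_geometric_of_lt_one hr0 hr1
  have h := (hβ.mul_prod hg).sum_antidiagonal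
  rw [div_eq_mul_inv]
  refine h.congr_fun fun c => ?_
  induction c with
  | zero => simp [h0]
  | succ c ih =>
    rw [hsucc, ih, Nat.sum_antidiagonal_succ', mul_sum]
    simp only [pow_zero, mul_one, pow_succ]
    congr 1
    exact sum_congr rfl fun p _ => by ring

/-- The value of `∑_c x ^ (2 c) * starPart l c N`. -/
noncomputable def starGen (x : ℝ) (l N : ℕ) : ℝ :=
  (∑ n ∈ range N, betaWeight x n * (1 / ((n : ℝ) + 1) ^ (l + 2))) / betaWeight x N

/-- Allowing the value `N + 1` adds the term of depth one and, since that value may be repeated,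
multiplies by `(1 - x ^ 2 / (N + 1) ^ 2)⁻¹`. This is the recurrence of `betaWeight` in the
denominator. -/
lemma hasSum_starPart {x : ℝ} (hx0 : 0 < x) (hx1 : x < 1) (l N : ℕ) :
    HasSum (fun c => (x ^ 2) ^ c * starPart l c N) (starGen x l N) := by
  induction N with
  | zero => simp [starGen, starPart_eq, hasSum_zero]
  | succ N ih =>
    have hM : (1 : ℝ) ≤ (N : ℝ) + 1 := by
      have : (0 : ℝ) ≤ N := by positivity
      linarith
    have hr1 : x ^ 2 / ((N : ℝ) + 1) ^ 2 < 1 := by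
      rw [div_lt_one (by positivity)]
      exact pow_lt_pow_left₀ (by linarith) hx0.le two_ne_zero
    have hadd := ih.add (hasSum_ite_eq (0 : ℕ) (1 / ((N : ℝ) + 1) ^ (l + 2)))
    have h := hasSum_of_geometric_recurrence (α := fun c => (x ^ 2) ^ c * starPart l c (N + 1))
      (by positivity : 0 ≤ x ^ 2 / ((N : ℝ) + 1) ^ 2) hr1 hadd
      (by simp [starPart_succ, starLast])
      (fun c => by
        rw [if_neg (Nat.succ_ne_zero c), starPart_succ l (c + 1), starLast]
        field_simp
        ring)
    convert h using 1
    have hK := betaWeight_pos hx0 hx1 N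
    have h1 : 1 - x ^ 2 / ((N : ℝ) + 1) ^ 2 ≠ 0 := by linarith
    rw [starGen, starGen, sum_range_succ, betaWeight_succ hx0]
    generalize 1 - x ^ 2 / ((N : ℝ) + 1) ^ 2 = ρ at *
    field_simp

lemma hasSum_starLast {x : ℝ} (hx0 : 0 < x) (hx1 : x < 1) (l n : ℕ) :
    HasSum (fun c => (x ^ 2) ^ c * starLast l c n) (starGen x l (n + 1) - starGen x l n) := by
  refine ((hasSum_starPart hx0 hx1 l (n + 1)).sub (hasSum_starPart hx0 hx1 l n)).congr_fun
    fun c => ?_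
  rw [starPart_succ]
  ring

/-- The sum telescopes, and the denominator `betaWeight x N` tends to `1`. -/
lemma hasSum_starGen_sub {x : ℝ} (hx0 : 0 < x) (hx1 : x < 1) (l : ℕ) :
    HasSum (fun n => starGen x l (n + 1) - starGen x l n) (betaSeries x l) := by
  rw [hasSum_iff_tendsto_nat_of_nonneg]
  · simp only [sum_range_sub]
    have h := (summable_betaWeight_mul hx0 hx1 l).hasSum.tendsto_sum_nat.div
      (tendsto_betaWeight hx0 hx1) one_ne_zero
    rw [div_one] at h
    simpa [starGen, betaSeries] using! h
  · intro n
    exact (hasSum_starLast hx0 hx1 l n).nonneg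
      (fun c => mul_nonneg (by positivity) (starLast_nonneg _ _ _))

lemma hasSum_mzsv {x : ℝ} (hx0 : 0 < x) (hx1 : x < 1) (l : ℕ) :
    HasSum (fun c => mzsv ((l + 2) :: List.replicate c 2) * (x ^ 2) ^ c) (betaSeries x l) := by
  set F : ℕ × ℕ → ℝ := fun p => (x ^ 2) ^ p.2 * starLast l p.2 p.1 with hF
  have hF0 : 0 ≤ F := fun p => mul_nonneg (by positivity) (starLast_nonneg _ _ _)
  have hfib : ∀ n, HasSum (fun c => F (n, c)) (starGen x l (n + 1) - starGen x l n) :=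
    hasSum_starLast hx0 hx1 l
  have hsum : Summable F := by
    rw [summable_prod_of_nonneg hF0]
    refine ⟨fun n => (hfib n).summable, ?_⟩
    simp only [(hfib _).tsum_eq]
    exact (hasSum_starGen_sub hx0 hx1 l).summable
  have htot : HasSum F (betaSeries x l) := by
    rw [(hasSum_starGen_sub hx0 hx1 l).unique (hsum.hasSum.prod_fiberwise hfib)]
    exact hsum.hasSum
  have hswap : HasSum (fun p : ℕ × ℕ => F (p.2, p.1)) (betaSeries x l) :=
    (Equiv.prodComm ℕ ℕ).hasSum_iff.2 htot
  refine hswap.prod_fiberwise fun c => ?_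
  have hs : Summable (starLast l c) := by
    refine ((hswap.summable.prod_factor c).mul_left ((x ^ 2) ^ c)⁻¹).congr fun n => ?_
    simp only [hF]
    field_simp
  rw [mzsv_eq_tsum, mul_comm]
  exact hs.hasSum.mul_left _

/-! ### Comparison of coefficients -/

/-- A power series vanishing on `(0, 1)` has zero coefficients. -/
lemma eq_zero_of_forall_hasSum_zero {d : ℕ → ℝ}
    (h : ∀ x : ℝ, 0 < x → x < 1 → HasSum (fun n => d n * x ^ n) 0) (n : ℕ) : d n = 0 := by
  induction n using Nat.strong_induction_on with
  | _ n ih =>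
  have hshift : ∀ x : ℝ, 0 < x → x < 1 → HasSum (fun i => d (i + n) * x ^ i) 0 := by
    intro x hx0 hx1
    have h1 := (hasSum_nat_add_iff' n).2 (h x hx0 hx1)
    rw [sum_eq_zero (fun i hi => by rw [ih i (mem_range.1 hi), zero_mul]), sub_zero] at h1
    have h2 := h1.mul_left (x ^ n)⁻¹
    rw [mul_zero] at h2
    refine h2.congr_fun fun i => ?_
    rw [pow_add]
    field_simp
  have htail : ∀ x : ℝ, 0 < x → x < 1 →
      HasSum (fun i => d (i + 1 + n) * x ^ i) (-d n * x⁻¹) := by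
    intro x hx0 hx1
    have h1 := ((hasSum_nat_add_iff' 1).2 (hshift x hx0 hx1)).mul_right x⁻¹
    simp only [sum_range_one, zero_add, pow_zero, mul_one, zero_sub] at h1
    refine h1.congr_fun fun i => ?_
    rw [pow_succ]
    field_simp
  have hC := (htail (1 / 2) (by norm_num) (by norm_num)).summable.norm
  -- Once the lower coefficients vanish, `d n` is `-x` times the tail series, which absolute
  -- convergence at `1 / 2` bounds uniformly for `x < 1 / 2`. Letting `x` tend to `0` gives `d n =
  -- 0`.
  have hle : ∀ x : ℝ, 0 < x → x < 1 / 2 →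
      |d n| ≤ (∑' i, ‖d (i + 1 + n) * (1 / 2) ^ i‖) * x := by
    intro x hx0 hx1
    have h1 := htail x hx0 (by linarith)
    have h2 : ‖∑' i, d (i + 1 + n) * x ^ i‖ ≤ ∑' i, ‖d (i + 1 + n) * (1 / 2) ^ i‖ := by
      refine tsum_of_norm_bounded hC.hasSum fun i => ?_
      rw [norm_mul, norm_mul, norm_pow, norm_pow]
      gcongr
      rw [Real.norm_of_nonneg hx0.le, Real.norm_of_nonneg (by norm_num)]
      exact hx1.le
    rw [h1.tsum_eq, norm_mul, norm_neg, norm_inv, Real.norm_of_nonneg hx0.le,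
      ← div_eq_mul_inv, div_le_iff₀ hx0] at h2
    exact h2
  have hlim : Filter.Tendsto (fun x : ℝ => (∑' i, ‖d (i + 1 + n) * (1 / 2) ^ i‖) * x)
      (nhdsWithin 0 (Set.Ioi 0)) (nhds 0) := by
    have h1 : Filter.Tendsto (fun x : ℝ => (∑' i, ‖d (i + 1 + n) * (1 / 2) ^ i‖) * x)
        (nhds 0) (nhds ((∑' i, ‖d (i + 1 + n) * (1 / 2) ^ i‖) * 0)) :=
      (continuous_const.mul continuous_id).tendsto 0
    rw [mul_zero] at h1
    exact h1.mono_left nhdsWithin_le_nhds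
  have h0 : |d n| ≤ 0 := by
    refine ge_of_tendsto hlim ?_
    filter_upwards [Ioo_mem_nhdsGT (show (0 : ℝ) < 1 / 2 by norm_num)] with x hx
    exact hle x hx.1 hx.2
  exact abs_eq_zero.1 (le_antisymm h0 (abs_nonneg _))

/-- The coefficients of the generating function of the zeta-star values. -/
noncomputable def starCoeff (n l : ℕ) : ℝ :=
  if Even n then mzsv ((l + 2) :: List.replicate (n / 2) 2) else 0

lemma starCoeff_two_mul (c l : ℕ) :
    starCoeff (2 * c) l = mzsv ((l + 2) :: List.replicate c 2) := by
  rw [starCoeff, if_pos (even_two_mul c), Nat.mul_div_cancel_left c two_pos]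

lemma alternatingSum_eq_starCoeff (n l : ℕ) : alternatingSum n l = starCoeff n l := by
  refine sub_eq_zero.1 (eq_zero_of_forall_hasSum_zero
    (d := fun n => alternatingSum n l - starCoeff n l) (fun x hx0 hx1 => ?_) n)
  have h1 := hasSum_alternatingSum hx0 hx1 l
  have hinj : Function.Injective (fun c : ℕ => 2 * c) := fun a b h => by
    simpa using h
  have h2 : HasSum (fun n => starCoeff n l * x ^ n) (betaSeries x l) := by
    rw [← hinj.hasSum_iff]
    · refine (hasSum_mzsv hx0 hx1 l).congr_fun fun c => ?_
      rw [Function.comp_apply, starCoeff_two_mul, pow_mul]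
    · intro n hn
      rw [starCoeff, if_neg, zero_mul]
      rintro ⟨c, rfl⟩
      exact hn ⟨c, by simp only; ring⟩
  have h3 := h1.sub h2
  rw [sub_self] at h3
  refine h3.congr_fun fun n => ?_
  ring

/-! ### From `t = 0` to general `t` -/

lemma sum_interpolatedMZV_shiftedIndex (t : ℝ) (b N l : ℕ) :
    ∑ k ∈ Nat.antidiagonalTuple (N + 1) l, interpolatedMZV t (shiftedIndex k b) =
      ∑ p ∈ antidiagonal N, t ^ p.1 * ((p.1 + l).choose l : ℝ) *
        ∑ k ∈ Nat.antidiagonalTuple (p.2 + 1) (l + p.1), mzv (shiftedIndex k b) := by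
  have h := boxedSum_eq_sum_plainSum t b N l 0 mzv
  simp only [boxedSum_eq, plainSum_eq, addHead_zero, ← interpolatedMZV_eq_boxSum] at h
  rw [h]
  refine sum_congr rfl fun p _ => ?_
  rw [Nat.choose_symm_add]

/-- The number of merged boxes does not involve `b`. For a fixed number of them, the remaining depth
and `b` run over an antidiagonal with the same signs, which is again an alternating sum. -/
lemma sum_interpolatedMZV_eq_sum_alternatingSum (n l : ℕ) (t : ℝ) :
    ∑ p ∈ antidiagonal n, (-1 : ℝ) ^ p.2 *
      ∑ k ∈ Nat.antidiagonalTuple (p.1 + 1) l, interpolatedMZV t (shiftedIndex k p.2) =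
    ∑ p ∈ antidiagonal n,
      t ^ p.1 * ((p.1 + l).choose l : ℝ) * alternatingSum p.2 (l + p.1) := by
  simp only [sum_interpolatedMZV_shiftedIndex, alternatingSum, mul_sum (s := antidiagonal _)]
  rw [sum_sigma', sum_sigma']
  refine sum_bij' (fun s _ => ⟨(s.2.1, s.2.2 + s.1.2), (s.2.2, s.1.2)⟩)
    (fun s _ => ⟨(s.1.1 + s.2.1, s.2.2), (s.1.1, s.2.1)⟩) ?_ ?_ ?_ ?_ ?_
  · rintro ⟨⟨i, b⟩, ⟨a, c⟩⟩ h
    simp only [mem_sigma, HasAntidiagonal.mem_antidiagonal] at h ⊢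
    obtain ⟨h1, h2⟩ := h
    exact ⟨by omega, trivial⟩
  · rintro ⟨⟨a, i⟩, ⟨c, b⟩⟩ h
    simp only [mem_sigma, HasAntidiagonal.mem_antidiagonal] at h ⊢
    obtain ⟨h1, h2⟩ := h
    exact ⟨by omega, trivial⟩
  · rintro ⟨⟨i, b⟩, ⟨a, c⟩⟩ h
    simp only [mem_sigma, HasAntidiagonal.mem_antidiagonal] at h
    rw [← h.2]
  · rintro ⟨⟨a, i⟩, ⟨c, b⟩⟩ h
    simp only [mem_sigma, HasAntidiagonal.mem_antidiagonal] at h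
    rw [← h.2]
  · rintro ⟨⟨i, b⟩, ⟨a, c⟩⟩ _
    ring

lemma sum_antidiagonal_starCoeff (n l : ℕ) (f : ℕ → ℝ) :
    ∑ p ∈ antidiagonal n, f p.1 * starCoeff p.2 (l + p.1) =
      ∑ p ∈ pairsAddTwoMul n, f p.1 * mzsv ((p.1 + l + 2) :: List.replicate p.2 2) := by
  rw [← sum_filter_of_ne (p := fun p : ℕ × ℕ => Even p.2)]
  · symm
    refine sum_bij' (fun p _ => (p.1, 2 * p.2)) (fun p _ => (p.1, p.2 / 2)) ?_ ?_ ?_ ?_ ?_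
    · rintro ⟨a, b⟩ h
      simp only [pairsAddTwoMul, mem_filter] at h
      simp [h.2]
    · rintro ⟨a, b⟩ h
      simp only [mem_filter, HasAntidiagonal.mem_antidiagonal] at h
      obtain ⟨h1, c, rfl⟩ := h
      simp only [pairsAddTwoMul, mem_filter, mem_product, mem_range]
      omega
    · rintro ⟨a, b⟩ _
      simp
    · rintro ⟨a, b⟩ h
      simp only [mem_filter] at h
      rw [Nat.mul_div_cancel' h.2.two_dvd]
    · rintro ⟨a, b⟩ _
      rw [starCoeff_two_mul, add_comm a l]
  · intro p _ h
    by_contra hp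
    rw [starCoeff, if_neg hp, mul_zero] at h
    exact h rfl

lemma sum_interpolatedMZV_shiftedIndex_eq (n l : ℕ) (t : ℝ) :
    ∑ p ∈ antidiagonal n, (-1 : ℝ) ^ p.2 *
      ∑ k ∈ Nat.antidiagonalTuple (p.1 + 1) l, interpolatedMZV t (shiftedIndex k p.2) =
    ∑ p ∈ pairsAddTwoMul n, t ^ p.1 * ((p.1 + l).choose l : ℝ) *
      mzsv ((p.1 + l + 2) :: List.replicate p.2 2) := by
  rw [sum_interpolatedMZV_eq_sum_alternatingSum]
  simp only [alternatingSum_eq_starCoeff]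
  exact sum_antidiagonal_starCoeff n l (fun a => t ^ a * ((a + l).choose l : ℝ))

lemma shiftedIndex_const_zero (a b : ℕ) :
    shiftedIndex (0 : Fin (a + 1) → ℕ) b = List.replicate a 1 ++ [b + 2] := by
  simp [shiftedIndex]

end

theorem theorem3p7 :
    -- the general formula
    (∀ (n l : ℕ) (t : ℝ),
      ∑ p ∈ Finset.HasAntidiagonal.antidiagonal n, (-1 : ℝ) ^ p.2 *
          ∑ k ∈ Finset.Nat.antidiagonalTuple (p.1 + 1) l,
            interpolatedMZV t (shiftedIndex k p.2) =
        ∑ p ∈ pairsAddTwoMul n,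
          t ^ p.1 * ((p.1 + l).choose l : ℝ) *
            mzsv ((p.1 + l + 2) :: List.replicate p.2 2)) ∧
    -- the case `t = 0`, for `n` even and for `n` odd
    (∀ l c : ℕ,
      ∑ p ∈ Finset.HasAntidiagonal.antidiagonal (2 * c), (-1 : ℝ) ^ p.2 *
          ∑ k ∈ Finset.Nat.antidiagonalTuple (p.1 + 1) l, mzv (shiftedIndex k p.2) =
        mzsv ((l + 2) :: List.replicate c 2)) ∧
    (∀ l c : ℕ,
      ∑ p ∈ Finset.HasAntidiagonal.antidiagonal (2 * c + 1), (-1 : ℝ) ^ p.2 *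
          ∑ k ∈ Finset.Nat.antidiagonalTuple (p.1 + 1) l, mzv (shiftedIndex k p.2) = 0) ∧
    -- the case `l = 0`
    (∀ (n : ℕ) (t : ℝ),
      ∑ p ∈ Finset.HasAntidiagonal.antidiagonal n, (-1 : ℝ) ^ p.2 *
          interpolatedMZV t (List.replicate p.1 1 ++ [p.2 + 2]) =
        ∑ p ∈ pairsAddTwoMul n,
          t ^ p.1 * mzsv ((p.1 + 2) :: List.replicate p.2 2)) := by
  refine ⟨sum_interpolatedMZV_shiftedIndex_eq, fun l c => ?_, fun l c => ?_, fun n t => ?_⟩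
  · rw [← starCoeff_two_mul, ← alternatingSum_eq_starCoeff, alternatingSum]
  · have h := alternatingSum_eq_starCoeff (2 * c + 1) l
    rwa [starCoeff, if_neg (Nat.not_even_iff_odd.2 (odd_two_mul_add_one c))] at h
  · simpa [Finset.Nat.antidiagonalTuple_zero_right, shiftedIndex_const_zero] using
      sum_interpolatedMZV_shiftedIndex_eq n 0 t
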